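/- Let $n > m > \ell \geq 2$ be integers. With the convention $[g,h] = g^{-1}h^{-1}gh$ for commutators, let $G$ and $H$ be the groups given by the presentations $$G = \langle\, x, y, z \mid x^{2^n} = 1,\ y^{2^m} = 1,\ z^{2^\ell} = 1,\ [y,x] = z,\ [z,x] = z^{-2},\ [z,y] = z^{-2} \,\rangle,$$ $$H = \langle\, a, b, c \mid a^{2^n} = 1,\ b^{2^m} = a^{2^m},\ c^{2^\ell} = 1,\ [b,a] = c,\ [c,a] = c^{-2},\ [c,b] = c^{-2} \,\rangle.$$ Let $R$ be a commutative ring with identity, and write $RG$ and $RH$ for the group algebras over $R$. 1. If $R$ has an ideal $\mathfrak{r}$ and a maximal ideal $\mathfrak{m}$ such that $\mathfrak{m}^2 \subseteq \mathfrak{r} \subseteq \mathfrak{m}$ and $R/\mathfrak{r}$ has characteristic $4$, then $RG$ and $RH$ are not isomorphic as $R$-algebras. In particular, $(\mathbb{Z}/4\mathbb{Z})G$ and $(\mathbb{Z}/4\mathbb{Z})H$ are not isomorphic as $\mathbb{Z}/4\mathbb{Z}$-algebras. 2. If $R$ has characteristic $2$, then $RG$ and $RH$ are isomorphic as $R$-algebras.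 -/

import Mathlib

universe u

/-- The group commutator `[g, h] = g⁻¹ h⁻¹ g h`.  Mathlib's bracket `⁅g, h⁆` is
`g * h * g⁻¹ * h⁻¹`, which is a different convention. -/
def rightComm {Γ : Type*} [Group Γ] (g h : Γ) : Γ := g⁻¹ * h⁻¹ * g * h

/-- The relators of
`⟨x, y, z | x^(2^n) = 1, y^(2^m) = 1, z^(2^l) = 1, [y,x] = z, [z,x] = z⁻², [z,y] = z⁻²⟩`,
where `x, y, z` are the free generators `0, 1, 2`; an equation `u = v` is
the relator `u * v⁻¹`. -/
def relatorsG (n m l : ℕ) : Set (FreeGroup (Fin 3)) :=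
  let x : FreeGroup (Fin 3) := FreeGroup.of 0
  let y : FreeGroup (Fin 3) := FreeGroup.of 1
  let z : FreeGroup (Fin 3) := FreeGroup.of 2
  {x ^ 2 ^ n,
    y ^ 2 ^ m,
    z ^ 2 ^ l,
    rightComm y x * z⁻¹,
    rightComm z x * (z ^ (-2 : ℤ))⁻¹,
    rightComm z y * (z ^ (-2 : ℤ))⁻¹}

/-- The relators of
`⟨a, b, c | a^(2^n) = 1, b^(2^m) = a^(2^m), c^(2^l) = 1, [b,a] = c, [c,a] = c⁻², [c,b] = c⁻²⟩`,
where `a, b, c` are the free generators `0, 1, 2`. -/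
def relatorsH (n m l : ℕ) : Set (FreeGroup (Fin 3)) :=
  let a : FreeGroup (Fin 3) := FreeGroup.of 0
  let b : FreeGroup (Fin 3) := FreeGroup.of 1
  let c : FreeGroup (Fin 3) := FreeGroup.of 2
  {a ^ 2 ^ n,
    b ^ 2 ^ m * (a ^ 2 ^ m)⁻¹,
    c ^ 2 ^ l,
    rightComm b a * c⁻¹,
    rightComm c a * (c ^ (-2 : ℤ))⁻¹,
    rightComm c b * (c ^ (-2 : ℤ))⁻¹}

/-- The group `G` with parameters `n, m, l`. -/
abbrev GroupG (n m l : ℕ) : Type := PresentedGroup (relatorsG n m l)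

/-- The group `H` with parameters `n, m, l`. -/
abbrev GroupH (n m l : ℕ) : Type := PresentedGroup (relatorsH n m l)

/-!
In both groups the squares of the first two generators are central, the commutator is `[y, x] =
(xy)⁻¹(yx)` with commuting factors, and the last two relations follow from this
(`IsInversionPair`). So each group is described by `x` and `y` alone: their squares are central,
`(xy)^(2^l) = (yx)^(2^l)`, `x^(2^n) = 1`, and `y^(2^m)` is `1` for `G` and `x^(2^m)` for `H`.

*Characteristic two.* The element `q = xy + yx` is central and `q^(2^l) = (xy)^(2^l) + (yx)^(2^l)
= 0`. Put `w = x + y + 1`. Then `w² = x² + y² + 1 + q`, so `w^(2^m) = x^(2^m) + y^(2^m) + 1`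
(`add_add_one_pow`), and `xw + wx = q`, so `x` and `w` satisfy the relations shared by the two
groups (`add_add_one`). Hence `y ↦ x + y + 1` exchanges the relations `y^(2^m) = 1` and `y^(2^m) =
x^(2^m)`; as it is an involution, it gives mutually inverse isomorphisms of the group algebras.

*Quotient of characteristic four.* The commutator ideal `K` of a group algebra is an invariant. In
`RG` it is generated by `yx - xy`, which anticommutes with `y` because `y²` is central; hence `y`
anticommutes with `K` modulo `K²` (`anticommutant` is the ideal that expresses this). An
isomorphism sends `y` to some `u ∈ RH` with `u^(2^m) = 1` that anticommutes with the commutator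
ideal of `RH` modulo its square. Let `v` be the sum of the coefficients of `u` at the group
elements of even length, where `a` and `b` have length one. An explicit representation of `H` by
affine maps of the plane over `S = R/r` (`swapAffine`; `a` acts as the swap of coordinates and `b`
as the swap followed by a translation) kills the square of the commutator ideal and turns the
anticommutation into `2v = 0` in `S` (`two_mul_eq_zero_of_mem`). Since `2 ∉ r` and `M² ⊆ r`, this
forces `v ∈ M`. On the other hand, raising to the `2^m`-th power is additive on the group algebra
over `R/M` of the cyclic group of order `2^(m+1)`, a quotient of `H` because `n > m`, and
comparing coefficients at the identity in `u^(2^m) = 1` gives `v^(2^m) = 1` in `R/M`, a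
contradiction (`not_mem_of_pow_eq_one`).
-/

/-! ### Pairs of elements with central squares -/

/-- The relations shared by `GroupG` and `GroupH`, in terms of the first two generators only:
`x²` and `y²` are central in the subgroup generated by `x` and `y`, and `(xy)^(2^l) = (yx)^(2^l)`.
Since `rightComm y x = (xy)⁻¹(yx)` with commuting factors, the last condition says that the
commutator has order dividing `2^l`. -/
structure IsInversionPair (l : ℕ) {Γ : Type*} [Monoid Γ] (x y : Γ) : Prop where
  sq_left : Commute (x ^ 2) y
  sq_right : Commute (y ^ 2) x
  pow_eq : (x * y) ^ 2 ^ l = (y * x) ^ 2 ^ l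

namespace IsInversionPair

section Monoid

variable {Γ Δ : Type*} [Monoid Γ] [Monoid Δ] {l : ℕ} {x y : Γ}

theorem map {F : Type*} [FunLike F Γ Δ] [MonoidHomClass F Γ Δ]
    (h : IsInversionPair l x y) (f : F) : IsInversionPair l (f x) (f y) where
  sq_left := by simpa using h.sq_left.map f
  sq_right := by simpa using h.sq_right.map f
  pow_eq := by simpa using congrArg f h.pow_eq

theorem of_units {x y : Γˣ} (h : IsInversionPair l (x : Γ) (y : Γ)) : IsInversionPair l x y where
  sq_left := Units.ext (by simpa using h.sq_left.eq)
  sq_right := Units.ext (by simpa using h.sq_right.eq)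
  pow_eq := Units.ext (by simpa using h.pow_eq)

theorem commute_mul_of_commute_sq (hx : Commute (x ^ 2) y) (hy : Commute (y ^ 2) x) :
    Commute (x * y) (y * x) := by
  have h1 : x * (y * y) = y * y * x := by simpa [pow_two] using hy.eq.symm
  have h2 : x * x * y = y * (x * x) := by simpa [pow_two] using hx.eq
  calc x * y * (y * x) = x * (y * y) * x := by simp only [mul_assoc]
    _ = y * (y * (x * x)) := by rw [h1]; simp only [mul_assoc]
    _ = y * (x * x * y) := by rw [h2]
    _ = y * x * (x * y) := by simp only [mul_assoc]

theorem commute_mul (h : IsInversionPair l x y) : Commute (x * y) (y * x) :=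
  commute_mul_of_commute_sq h.sq_left h.sq_right

end Monoid

variable {Γ : Type*} [Group Γ] {l : ℕ} {x y : Γ}

theorem rightComm_eq (x y : Γ) : rightComm y x = (x * y)⁻¹ * (y * x) := by
  simp [rightComm, mul_assoc]

theorem rightComm_eq_zpow_iff (z g : Γ) : rightComm z g = z ^ (-2 : ℤ) ↔ z * g = g * z⁻¹ := by
  rw [rightComm, zpow_neg, zpow_two, mul_inv_rev, mul_assoc, mul_assoc, mul_right_inj,
    inv_mul_eq_iff_eq_mul]

theorem rightComm_pow (h : IsInversionPair l x y) : rightComm y x ^ 2 ^ l = 1 := by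
  rw [rightComm_eq, h.commute_mul.inv_left.mul_pow, inv_pow, h.pow_eq, inv_mul_cancel]

theorem rightComm_rightComm_left (h : IsInversionPair l x y) :
    rightComm (rightComm y x) x = rightComm y x ^ (-2 : ℤ) := by
  rw [rightComm_eq_zpow_iff]
  have h2 : y * (x * x) = x * (x * y) := by simpa [pow_two, mul_assoc] using h.sq_left.eq.symm
  simp [rightComm, mul_assoc, h2]

theorem rightComm_rightComm_right (h : IsInversionPair l x y) :
    rightComm (rightComm y x) y = rightComm y x ^ (-2 : ℤ) := by
  rw [rightComm_eq_zpow_iff]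
  have h2 : y⁻¹ * x⁻¹ * y = y * x⁻¹ * y⁻¹ := by
    rw [eq_mul_inv_iff_mul_eq, mul_assoc, mul_assoc, inv_mul_eq_iff_eq_mul,
      ← pow_two, ← mul_assoc y, ← pow_two, h.sq_right.inv_right.eq]
  simpa [rightComm, mul_assoc] using congrArg (· * (x * y)) h2

theorem of_rightComm (hz : rightComm y x ^ 2 ^ l = 1)
    (hx : rightComm (rightComm y x) x = rightComm y x ^ (-2 : ℤ))
    (hy : rightComm (rightComm y x) y = rightComm y x ^ (-2 : ℤ)) : IsInversionPair l x y := by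
  rw [rightComm_eq_zpow_iff] at hx hy
  have hyx : y * x = x * y * rightComm y x := by rw [rightComm_eq, mul_inv_cancel_left]
  have hsl : Commute (x ^ 2) y := by
    have : y * x * x = x * x * y := by
      rw [hyx, mul_assoc, hx, mul_assoc, ← mul_assoc y, hyx, mul_inv_cancel_right, mul_assoc]
    rw [Commute, SemiconjBy, pow_two, ← this, mul_assoc]
  have hsr : Commute (y ^ 2) x := by
    rw [Commute, SemiconjBy, pow_two, mul_assoc, hyx, ← mul_assoc, ← mul_assoc, hyx, mul_assoc,
      mul_assoc (x * y), ← mul_assoc _ y, hy, inv_mul_cancel_right, mul_assoc]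
  refine ⟨hsl, hsr, ?_⟩
  rw [rightComm_eq, (commute_mul_of_commute_sq hsl hsr).inv_left.mul_pow, inv_pow,
    inv_mul_eq_one] at hz
  exact hz

end IsInversionPair

/-! ### The presentations in terms of two generators -/

/-- The relators common to `relatorsG` and `relatorsH`: those that involve the third generator. -/
def commutatorRelators (l : ℕ) : Set (FreeGroup (Fin 3)) :=
  {.of 2 ^ 2 ^ l,
    rightComm (.of 1) (.of 0) * (.of 2)⁻¹,
    rightComm (.of 2) (.of 0) * (.of 2 ^ (-2 : ℤ))⁻¹,
    rightComm (.of 2) (.of 1) * (.of 2 ^ (-2 : ℤ))⁻¹}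

theorem relatorsG_eq (n m l : ℕ) :
    relatorsG n m l = {.of 0 ^ 2 ^ n, .of 1 ^ 2 ^ m} ∪ commutatorRelators l := by
  simp only [relatorsG, commutatorRelators, Set.insert_union, Set.singleton_union]

theorem relatorsH_eq (n m l : ℕ) :
    relatorsH n m l =
      {.of 0 ^ 2 ^ n, .of 1 ^ 2 ^ m * (.of 0 ^ 2 ^ m)⁻¹} ∪ commutatorRelators l := by
  simp only [relatorsH, commutatorRelators, Set.insert_union, Set.singleton_union]

theorem lift_rightComm {α Γ : Type*} [Group Γ] (f : α → Γ) (u v : FreeGroup α) :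
    FreeGroup.lift f (rightComm u v) = rightComm (FreeGroup.lift f u) (FreeGroup.lift f v) := by
  simp [rightComm]

theorem IsInversionPair.lift_eq_one {l : ℕ} {Γ : Type*} [Group Γ] {x y : Γ}
    (h : IsInversionPair l x y) {r : FreeGroup (Fin 3)} (hr : r ∈ commutatorRelators l) :
    FreeGroup.lift ![x, y, rightComm y x] r = 1 := by
  obtain rfl | rfl | rfl | rfl := hr
  · simpa using h.rightComm_pow
  · simp [lift_rightComm]
  · rw [map_mul, map_inv, mul_inv_eq_one]
    simpa [lift_rightComm] using h.rightComm_rightComm_left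
  · rw [map_mul, map_inv, mul_inv_eq_one]
    simpa [lift_rightComm] using h.rightComm_rightComm_right

section CommutatorRelators

variable {l : ℕ} {rels : Set (FreeGroup (Fin 3))}

theorem of_two_eq_rightComm (hrels : commutatorRelators l ⊆ rels) :
    (PresentedGroup.of 2 : PresentedGroup rels) =
      rightComm (PresentedGroup.of 1) (PresentedGroup.of 0) :=
  (PresentedGroup.mk_eq_mk_of_mul_inv_mem (x := rightComm (.of 1) (.of 0)) (y := .of 2)
    (hrels (by simp [commutatorRelators]))).symm

theorem isInversionPair_of (hrels : commutatorRelators l ⊆ rels) :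
    IsInversionPair l (PresentedGroup.of 0 : PresentedGroup rels) (PresentedGroup.of 1) := by
  refine .of_rightComm ?_ ?_ ?_ <;> rw [← of_two_eq_rightComm hrels]
  · exact PresentedGroup.one_of_mem (x := .of 2 ^ 2 ^ l) (hrels (by simp [commutatorRelators]))
  · exact PresentedGroup.mk_eq_mk_of_mul_inv_mem (x := rightComm (.of 2) (.of 0))
      (y := .of 2 ^ (-2 : ℤ)) (hrels (by simp [commutatorRelators]))
  · exact PresentedGroup.mk_eq_mk_of_mul_inv_mem (x := rightComm (.of 2) (.of 1))
      (y := .of 2 ^ (-2 : ℤ)) (hrels (by simp [commutatorRelators]))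

theorem subgroup_eq_top (hrels : commutatorRelators l ⊆ rels) (K : Subgroup (PresentedGroup rels))
    (h0 : PresentedGroup.of 0 ∈ K) (h1 : PresentedGroup.of 1 ∈ K) (g : PresentedGroup rels) :
    g ∈ K := by
  refine PresentedGroup.generated_by rels K (fun j ↦ ?_) g
  fin_cases j
  · exact h0
  · exact h1
  · change PresentedGroup.of 2 ∈ K
    rw [of_two_eq_rightComm hrels]
    exact K.mul_mem (K.mul_mem (K.mul_mem (K.inv_mem h1) (K.inv_mem h0)) h1) h0

theorem monoidHom_ext (hrels : commutatorRelators l ⊆ rels) {M : Type*} [Monoid M]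
    {φ ψ : PresentedGroup rels →* M}
    (h0 : φ (PresentedGroup.of 0) = ψ (PresentedGroup.of 0))
    (h1 : φ (PresentedGroup.of 1) = ψ (PresentedGroup.of 1)) : φ = ψ := by
  let K : Subgroup (PresentedGroup rels) :=
    { MonoidHom.eqLocusM φ ψ with inv_mem' := fun h ↦ eq_on_inv φ ψ h }
  exact MonoidHom.ext (subgroup_eq_top hrels K h0 h1)

end CommutatorRelators

namespace GroupG

theorem commutatorRelators_subset (n m l : ℕ) : commutatorRelators l ⊆ relatorsG n m l := by
  rw [relatorsG_eq]; exact Set.subset_union_right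

variable {n m l : ℕ}

theorem of_zero_pow : (PresentedGroup.of 0 : GroupG n m l) ^ 2 ^ n = 1 :=
  PresentedGroup.one_of_mem (x := .of 0 ^ 2 ^ n) (by simp [relatorsG])

theorem of_one_pow : (PresentedGroup.of 1 : GroupG n m l) ^ 2 ^ m = 1 :=
  PresentedGroup.one_of_mem (x := .of 1 ^ 2 ^ m) (by simp [relatorsG])

/-- The homomorphism out of `GroupG` that sends the first two generators to `x` and `y`. -/
def lift {Γ : Type*} [Group Γ] (x y : Γ) (hx : x ^ 2 ^ n = 1)
    (hy : y ^ 2 ^ m = 1) (h : IsInversionPair l x y) : GroupG n m l →* Γ :=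
  PresentedGroup.toGroup (f := ![x, y, rightComm y x]) <| by
    rw [relatorsG_eq]
    rintro r ((rfl | rfl) | hr)
    · simpa using hx
    · simpa using hy
    · exact h.lift_eq_one hr

section

variable {Γ : Type*} [Group Γ] {x y : Γ} (hx : x ^ 2 ^ n = 1) (hy : y ^ 2 ^ m = 1)
  (h : IsInversionPair l x y)

@[simp] theorem lift_of_zero : lift x y hx hy h (PresentedGroup.of 0) = x :=
  PresentedGroup.toGroup.of _

@[simp] theorem lift_of_one : lift x y hx hy h (PresentedGroup.of 1) = y :=
  PresentedGroup.toGroup.of _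

end

end GroupG

namespace GroupH

theorem commutatorRelators_subset (n m l : ℕ) : commutatorRelators l ⊆ relatorsH n m l := by
  rw [relatorsH_eq]; exact Set.subset_union_right

variable {n m l : ℕ}

theorem of_zero_pow : (PresentedGroup.of 0 : GroupH n m l) ^ 2 ^ n = 1 :=
  PresentedGroup.one_of_mem (x := .of 0 ^ 2 ^ n) (by simp [relatorsH])

theorem of_one_pow :
    (PresentedGroup.of 1 : GroupH n m l) ^ 2 ^ m = PresentedGroup.of 0 ^ 2 ^ m :=
  PresentedGroup.mk_eq_mk_of_mul_inv_mem (x := .of 1 ^ 2 ^ m) (y := .of 0 ^ 2 ^ m)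
    (by simp [relatorsH])

/-- The homomorphism out of `GroupH` that sends the first two generators to `x` and `y`. -/
def lift {Γ : Type*} [Group Γ] (x y : Γ) (hx : x ^ 2 ^ n = 1)
    (hy : y ^ 2 ^ m = x ^ 2 ^ m) (h : IsInversionPair l x y) : GroupH n m l →* Γ :=
  PresentedGroup.toGroup (f := ![x, y, rightComm y x]) <| by
    rw [relatorsH_eq]
    rintro r ((rfl | rfl) | hr)
    · simpa using hx
    · simpa [mul_inv_eq_one] using hy
    · exact h.lift_eq_one hr

section

variable {Γ : Type*} [Group Γ] {x y : Γ} (hx : x ^ 2 ^ n = 1) (hy : y ^ 2 ^ m = x ^ 2 ^ m)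
  (h : IsInversionPair l x y)

@[simp] theorem lift_of_zero : lift x y hx hy h (PresentedGroup.of 0) = x :=
  PresentedGroup.toGroup.of _

@[simp] theorem lift_of_one : lift x y hx hy h (PresentedGroup.of 1) = y :=
  PresentedGroup.toGroup.of _

end

end GroupH

/-! ### The isomorphism in characteristic two -/

namespace IsInversionPair

section Ring

variable {T : Type*} [Ring T] {l m : ℕ} {x y : T}

theorem commute_add_left (h : IsInversionPair l x y) : Commute (x * y + y * x) x := by
  have h2 : x * x * y = y * (x * x) := by simpa [pow_two] using h.sq_left.eq
  rw [Commute, SemiconjBy, add_mul, mul_add, ← mul_assoc x x y, h2, mul_assoc y x x, mul_assoc,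
    add_comm]

theorem commute_add_right (h : IsInversionPair l x y) : Commute (x * y + y * x) y := by
  have h2 : y * y * x = x * (y * y) := by simpa [pow_two] using h.sq_right.eq
  rw [Commute, SemiconjBy, add_mul, mul_add, ← mul_assoc y y x, h2, mul_assoc x y y, mul_assoc,
    add_comm]

variable [CharP T 2]

theorem add_pow_eq_zero (h : IsInversionPair l x y) {k : ℕ} (hk : l ≤ k) :
    (x * y + y * x) ^ 2 ^ k = 0 := by
  refine pow_eq_zero_of_le (Nat.pow_le_pow_right two_pos hk) ?_
  rw [add_pow_char_pow_of_commute _ _ h.commute_mul, h.pow_eq, CharTwo.add_self_eq_zero]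

theorem add_add_one_sq (x y : T) :
    (x + y + 1) ^ 2 = x ^ 2 + y ^ 2 + 1 + (x * y + y * x) := by
  have h2 (t : T) : t + t = 0 := CharTwo.add_self_eq_zero t
  calc (x + y + 1) ^ 2 = x ^ 2 + y ^ 2 + 1 + (x * y + y * x) + (x + x) + (y + y) := by noncomm_ring
    _ = _ := by simp only [h2, add_zero]

/-- In characteristic two, replacing `y` by `x + y + 1` preserves `xy + yx`, whose `2^l`-th power
vanishes; this is what makes the commutator of the new pair have order dividing `2^l`. -/
theorem add_add_one (h : IsInversionPair l x y) : IsInversionPair l x (x + y + 1) := by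
  have hl : Commute (x ^ 2) (x + y + 1) :=
    (((Commute.refl x).pow_left 2).add_right h.sq_left).add_right (.one_right _)
  have hr : Commute ((x + y + 1) ^ 2) x := by
    rw [add_add_one_sq]
    exact ((((Commute.refl x).pow_left 2).add_left h.sq_right).add_left (.one_left _)).add_left
      h.commute_add_left
  refine ⟨hl, hr, ?_⟩
  have key : x * (x + y + 1) + (x + y + 1) * x = x * y + y * x := by
    calc x * (x + y + 1) + (x + y + 1) * x
        = x * y + y * x + (x * x + x * x) + (x + x) := by noncomm_ring
      _ = _ := by simp only [CharTwo.add_self_eq_zero, add_zero]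
  rw [← CharTwo.add_eq_zero, ← add_pow_char_pow_of_commute _ _ (commute_mul_of_commute_sq hl hr),
    key, h.add_pow_eq_zero le_rfl]

theorem add_add_one_pow (h : IsInversionPair l x y) (hlm : l < m) :
    (x + y + 1) ^ 2 ^ m = x ^ 2 ^ m + y ^ 2 ^ m + 1 := by
  obtain ⟨k, rfl⟩ : ∃ k, m = k + 1 := ⟨m - 1, by omega⟩
  have hq : Commute (x ^ 2 + y ^ 2 + 1) (x * y + y * x) :=
    ((h.commute_add_left.symm.pow_left 2).add_left
      (h.commute_add_right.symm.pow_left 2)).add_left (.one_left _)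
  simp only [pow_succ' 2 k, pow_mul]
  rw [add_add_one_sq, add_pow_char_pow_of_commute _ _ hq, h.add_pow_eq_zero (by omega), add_zero,
    add_pow_char_pow_of_commute _ _ (.one_right _),
    add_pow_char_pow_of_commute _ _ (h.sq_left.pow_right 2), one_pow]

theorem add_add_one_add_add_one (x y : T) : x + (x + y + 1) + 1 = y := by
  rw [show x + (x + y + 1) + 1 = (x + x) + y + (1 + 1) by abel]
  simp [CharTwo.add_self_eq_zero]

end Ring

end IsInversionPair

section GroupAlgebra

open MonoidAlgebra

variable {n m l : ℕ} {R T : Type*} [CommRing R] [Ring T] [Algebra R T] {a b : T}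

theorem algHom_ext_of_generators {rels : Set (FreeGroup (Fin 3))}
    (hrels : commutatorRelators l ⊆ rels) {F F' : MonoidAlgebra R (PresentedGroup rels) →ₐ[R] T}
    (h0 : F (of R _ (.of 0)) = F' (of R _ (.of 0)))
    (h1 : F (of R _ (.of 1)) = F' (of R _ (.of 1))) : F = F' :=
  MonoidAlgebra.algHom_ext' (monoidHom_ext hrels h0 h1) (by ext)

theorem ringHom_ext_of_generators {rels : Set (FreeGroup (Fin 3))} {T : Type*} [Ring T]
    (hrels : commutatorRelators l ⊆ rels) {F F' : MonoidAlgebra R (PresentedGroup rels) →+* T}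
    (h : ∀ r, F (algebraMap R _ r) = F' (algebraMap R _ r))
    (h0 : F (of R _ (.of 0)) = F' (of R _ (.of 0)))
    (h1 : F (of R _ (.of 1)) = F' (of R _ (.of 1))) : F = F' :=
  MonoidAlgebra.ringHom_ext' (RingHom.ext h) (monoidHom_ext hrels h0 h1)

theorem isInversionPair_groupAlgebra {rels : Set (FreeGroup (Fin 3))}
    (hrels : commutatorRelators l ⊆ rels) :
    IsInversionPair l (of R (PresentedGroup rels) (.of 0)) (of R _ (.of 1)) :=
  (isInversionPair_of hrels).map _

/-- The algebra homomorphism out of the group algebra of `GroupG` given by the images of the first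
two generators. -/
theorem GroupG.exists_algHom (h : IsInversionPair l a b) (ha : a ^ 2 ^ n = 1)
    (hb : b ^ 2 ^ m = 1) : ∃ F : MonoidAlgebra R (GroupG n m l) →ₐ[R] T,
      F (of R _ (.of 0)) = a ∧ F (of R _ (.of 1)) = b := by
  have hua : IsUnit a := .of_pow_eq_one ha (by positivity)
  have hub : IsUnit b := .of_pow_eq_one hb (by positivity)
  lift a to Tˣ using hua
  lift b to Tˣ using hub
  refine ⟨MonoidAlgebra.lift R T _ ((Units.coeHom T).comp
    (GroupG.lift a b ?_ ?_ (.of_units h))), ?_, ?_⟩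
  · exact Units.ext (by simpa using ha)
  · exact Units.ext (by simpa using hb)
  · simp
  · simp

/-- The algebra homomorphism out of the group algebra of `GroupH` given by the images of the first
two generators. -/
theorem GroupH.exists_algHom (h : IsInversionPair l a b) (ha : a ^ 2 ^ n = 1)
    (hb : b ^ 2 ^ m = a ^ 2 ^ m) : ∃ F : MonoidAlgebra R (GroupH n m l) →ₐ[R] T,
      F (of R _ (.of 0)) = a ∧ F (of R _ (.of 1)) = b := by
  have hua : IsUnit a := .of_pow_eq_one ha (by positivity)
  have hub : IsUnit b := (isUnit_pow_iff (n := 2 ^ m) (by positivity)).1 (hb ▸ hua.pow _)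
  lift a to Tˣ using hua
  lift b to Tˣ using hub
  refine ⟨MonoidAlgebra.lift R T _ ((Units.coeHom T).comp
    (GroupH.lift a b ?_ ?_ (.of_units h))), ?_, ?_⟩
  · exact Units.ext (by simpa using ha)
  · exact Units.ext (by simpa using hb)
  · simp
  · simp

theorem MonoidAlgebra.charP (R Γ : Type*) [CommRing R] [Monoid Γ] (p : ℕ) [CharP R p] :
    CharP (MonoidAlgebra R Γ) p :=
  charP_of_injective_ringHom (f := (MonoidAlgebra.singleOneRingHom : R →+* MonoidAlgebra R Γ))
    (fun r s h ↦ by simpa using congrArg (fun t : MonoidAlgebra R Γ ↦ t.coeff 1) h) p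

/-- In characteristic two the substitution `(x, y) ↦ (x, x + y + 1)` is an involution that exchanges
the defining relations of `GroupG` and `GroupH`. -/
theorem nonempty_algEquiv_of_charTwo [CharP R 2] (hlm : l < m) :
    Nonempty (MonoidAlgebra R (GroupG n m l) ≃ₐ[R] MonoidAlgebra R (GroupH n m l)) := by
  have := MonoidAlgebra.charP R (GroupG n m l) 2
  have := MonoidAlgebra.charP R (GroupH n m l) 2
  have hG : IsInversionPair l (of R (GroupG n m l) (.of 0)) (of R _ (.of 1)) :=
    isInversionPair_groupAlgebra (GroupG.commutatorRelators_subset n m l)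
  have hH : IsInversionPair l (of R (GroupH n m l) (.of 0)) (of R _ (.of 1)) :=
    isInversionPair_groupAlgebra (GroupH.commutatorRelators_subset n m l)
  obtain ⟨F, hF0, hF1⟩ := GroupG.exists_algHom (n := n) (m := m) (R := R) hH.add_add_one
    (by rw [← map_pow, GroupH.of_zero_pow, map_one])
    (by rw [hH.add_add_one_pow hlm, ← map_pow, ← map_pow, GroupH.of_one_pow,
          CharTwo.add_self_eq_zero, zero_add])
  obtain ⟨F', hF'0, hF'1⟩ := GroupH.exists_algHom (n := n) (m := m) (R := R) hG.add_add_one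
    (by rw [← map_pow, GroupG.of_zero_pow, map_one])
    (by rw [hG.add_add_one_pow hlm, ← map_pow, ← map_pow, GroupG.of_one_pow, map_one, add_assoc,
          CharTwo.add_self_eq_zero, add_zero])
  refine ⟨AlgEquiv.ofAlgHom F F' ?_ ?_⟩
  · refine algHom_ext_of_generators (GroupH.commutatorRelators_subset n m l) ?_ ?_
    · simp only [AlgHom.comp_apply, hF'0, hF0, AlgHom.id_apply]
    · simp only [AlgHom.comp_apply, hF'1, map_add, map_one, hF0, hF1, AlgHom.id_apply]
      exact IsInversionPair.add_add_one_add_add_one _ _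
  · refine algHom_ext_of_generators (GroupG.commutatorRelators_subset n m l) ?_ ?_
    · simp only [AlgHom.comp_apply, hF'0, hF0, AlgHom.id_apply]
    · simp only [AlgHom.comp_apply, hF1, map_add, map_one, hF'0, hF'1, AlgHom.id_apply]
      exact IsInversionPair.add_add_one_add_add_one _ _

end GroupAlgebra

/-! ### Ideals of anticommuting elements -/

/-- The elements of `N` that anticommute with `v`, where `N` is a two-sided ideal of square zero
that contains all commutators. They form an ideal because `v * b - b * v` annihilates `N` for
every `b`. -/
def anticommutant {B : Type*} [Ring B] (N : TwoSidedIdeal B)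
    (hN : ∀ x ∈ N, ∀ y ∈ N, x * y = 0) (hc : ∀ x y : B, x * y - y * x ∈ N) (v : B) :
    TwoSidedIdeal B :=
  .mk' {a | a ∈ N ∧ v * a + a * v = 0}
    ⟨N.zero_mem, by simp⟩
    (by
      rintro a b ⟨ha, ha'⟩ ⟨hb, hb'⟩
      refine ⟨N.add_mem ha hb, ?_⟩
      rw [mul_add, add_mul, add_add_add_comm, ha', hb', add_zero])
    (by
      rintro a ⟨ha, ha'⟩
      refine ⟨N.neg_mem ha, ?_⟩
      rw [mul_neg, neg_mul, ← neg_add, ha', neg_zero])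
    (by
      rintro b a ⟨ha, ha'⟩
      refine ⟨N.mul_mem_left b a ha, ?_⟩
      calc v * (b * a) + b * a * v = (v * b - b * v) * a + b * (v * a + a * v) := by noncomm_ring
        _ = 0 := by rw [ha', hN _ (hc v b) a ha, mul_zero, add_zero])
    (by
      rintro a b ⟨ha, ha'⟩
      refine ⟨N.mul_mem_right a b ha, ?_⟩
      calc v * (a * b) + a * b * v = a * (b * v - v * b) + (v * a + a * v) * b := by noncomm_ring
        _ = 0 := by rw [ha', hN a ha _ (hc b v), zero_mul, add_zero])

theorem mem_anticommutant {B : Type*} [Ring B] {N : TwoSidedIdeal B}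
    {hN : ∀ x ∈ N, ∀ y ∈ N, x * y = 0} {hc : ∀ x y : B, x * y - y * x ∈ N} {v a : B} :
    a ∈ anticommutant N hN hc v ↔ a ∈ N ∧ v * a + a * v = 0 :=
  TwoSidedIdeal.mem_mk' ..

/-- As `y²` commutes with `x`, the commutator `yx - xy` anticommutes with `y`. -/
theorem commutator_mem_anticommutant {B : Type*} [Ring B] {N : TwoSidedIdeal B}
    (hN : ∀ x ∈ N, ∀ y ∈ N, x * y = 0) (hc : ∀ x y : B, x * y - y * x ∈ N) {x y : B} {l : ℕ}
    (h : IsInversionPair l x y) : y * x - x * y ∈ anticommutant N hN hc y := by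
  refine mem_anticommutant.2 ⟨hc y x, ?_⟩
  calc y * (y * x - x * y) + (y * x - x * y) * y = y ^ 2 * x - x * y ^ 2 := by noncomm_ring
    _ = 0 := sub_eq_zero.2 h.sq_right.eq

section Commute

variable {l : ℕ} {rels : Set (FreeGroup (Fin 3))} {R B : Type*} [CommRing R] [Ring B] [Algebra R B]

theorem commute_of_commute_generators (hrels : commutatorRelators l ⊆ rels)
    (F : MonoidAlgebra R (PresentedGroup rels) →ₐ[R] B) {t : B}
    (h0 : Commute t (F (.of R _ (.of 0)))) (h1 : Commute t (F (.of R _ (.of 1))))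
    (w : MonoidAlgebra R (PresentedGroup rels)) : Commute t (F w) := by
  let φ : PresentedGroup rels →* B := (F : _ →* B).comp (MonoidAlgebra.of R _)
  let K : Subgroup (PresentedGroup rels) :=
    { carrier := {g | Commute t (φ g)}
      mul_mem' := fun {g h} (hg : Commute t (φ g)) (hh : Commute t (φ h)) ↦
        show Commute t (φ (g * h)) from map_mul φ g h ▸ hg.mul_right hh
      one_mem' := show Commute t (φ 1) from map_one φ ▸ .one_right t
      inv_mem' := fun {g} (hg : Commute t (φ.toHomUnits g)) ↦
        show Commute t (φ.toHomUnits g⁻¹) by rw [map_inv]; exact hg.units_inv_right }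
  induction w using MonoidAlgebra.induction_linear with
  | zero => simp
  | add x y hx hy => rw [map_add]; exact hx.add_right hy
  | single g r =>
    have hg : Commute t (F (.single g 1)) := subgroup_eq_top hrels K h0 h1 g
    rw [← mul_one r, ← smul_eq_mul, ← MonoidAlgebra.smul_single, map_smul]
    exact hg.smul_right r

/-- If the images of the two generators commute modulo an ideal, then so do the images of all
elements of the group algebra. -/
theorem commutator_mem_of_generators (hrels : commutatorRelators l ⊆ rels)
    (F : MonoidAlgebra R (PresentedGroup rels) →ₐ[R] B) (D : TwoSidedIdeal B)
    (hD : F (.of R _ (.of 1)) * F (.of R _ (.of 0)) - F (.of R _ (.of 0)) * F (.of R _ (.of 1)) ∈ D)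
    (u w : MonoidAlgebra R (PresentedGroup rels)) : F u * F w - F w * F u ∈ D := by
  let π := (D.ringCon.mkₐ R).comp F
  have hπ (u w) : F u * F w - F w * F u ∈ D ↔ Commute (π u) (π w) := by
    rw [← TwoSidedIdeal.rel_iff, ← RingCon.eq]
    rfl
  have step {t} := commute_of_commute_generators hrels π (t := t)
  have h10 := (hπ _ _).1 hD
  exact (hπ u w).2 (step (step (.refl _) h10.symm u).symm (step h10 (.refl _) u).symm w)

end Commute

/-! ### Affine maps of the plane whose linear part is a combination of identity and swap -/

/-- The `R`-algebra of matrices `!![p, q, s; q, p, t; 0, 0, p + q]` over an `R`-algebra `S`. For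
`(p, q) = (1, 0)` and `(p, q) = (0, 1)` these are the affine maps of the plane `S × S`, in
homogeneous coordinates, whose linear part is the identity or the swap of coordinates. -/
def swapAffine (R S : Type*) [CommRing R] [CommRing S] [Algebra R S] :
    Subalgebra R (Matrix (Fin 3) (Fin 3) S) where
  carrier := {A | A 1 1 = A 0 0 ∧ A 1 0 = A 0 1 ∧ A 2 0 = 0 ∧ A 2 1 = 0 ∧ A 2 2 = A 0 0 + A 0 1}
  mul_mem' := by
    rintro A B ⟨a1, a2, a3, a4, a5⟩ ⟨b1, b2, b3, b4, b5⟩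
    simp only [Set.mem_ofPred_eq, Matrix.mul_apply, Fin.sum_univ_three, a1, a2, a3, a4, a5, b1, b2,
      b3, b4, b5]
    refine ⟨?_, ?_, ?_, ?_, ?_⟩ <;> ring
  add_mem' := by
    rintro A B ⟨a1, a2, a3, a4, a5⟩ ⟨b1, b2, b3, b4, b5⟩
    simp only [Set.mem_ofPred_eq, Matrix.add_apply, a1, a2, a3, a4, a5, b1, b2, b3, b4, b5]
    refine ⟨trivial, trivial, add_zero 0, add_zero 0, by ring⟩
  algebraMap_mem' r := by simp [Matrix.algebraMap_matrix_apply]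

namespace swapAffine

variable {R S : Type*} [CommRing R] [CommRing S] [Algebra R S]

/-- The matrix `!![p, q, s; q, p, t; 0, 0, p + q]`. -/
def mk (p q s t : S) : swapAffine R S :=
  ⟨!![p, q, s; q, p, t; 0, 0, p + q], by simp [swapAffine]⟩

theorem eq_mk (A : swapAffine R S) : A = mk (A.1 0 0) (A.1 0 1) (A.1 0 2) (A.1 1 2) := by
  obtain ⟨A, a1, a2, a3, a4, a5⟩ := A
  refine Subtype.ext ?_
  ext i j
  fin_cases i <;> fin_cases j <;> simp [mk, *]

theorem exists_eq_mk (A : swapAffine R S) : ∃ p q s t, A = mk p q s t := ⟨_, _, _, _, eq_mk A⟩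

theorem mk_mul_mk (p q s t p' q' s' t' : S) : (mk p q s t * mk p' q' s' t' : swapAffine R S) =
    mk (p * p' + q * q') (p * q' + q * p') (p * s' + q * t' + s * (p' + q'))
      (q * s' + p * t' + t * (p' + q')) := by
  refine Subtype.ext ?_
  ext i j
  fin_cases i <;> fin_cases j <;>
    simp [mk, Matrix.mul_apply, Fin.sum_univ_three] <;> ring

theorem mk_add_mk (p q s t p' q' s' t' : S) : (mk p q s t + mk p' q' s' t' : swapAffine R S) =
    mk (p + p') (q + q') (s + s') (t + t') := by
  refine Subtype.ext ?_
  ext i j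
  fin_cases i <;> fin_cases j <;> simp [mk]; ring

theorem neg_mk (p q s t : S) : (-mk p q s t : swapAffine R S) = mk (-p) (-q) (-s) (-t) := by
  refine Subtype.ext ?_
  ext i j
  fin_cases i <;> fin_cases j <;> simp [mk]; ring

theorem mk_sub_mk (p q s t p' q' s' t' : S) : (mk p q s t - mk p' q' s' t' : swapAffine R S) =
    mk (p - p') (q - q') (s - s') (t - t') := by
  simp only [sub_eq_add_neg, neg_mk, mk_add_mk]

theorem mk_inj {p q s t p' q' s' t' : S} : (mk p q s t : swapAffine R S) = mk p' q' s' t' ↔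
    p = p' ∧ q = q' ∧ s = s' ∧ t = t' := by
  refine ⟨fun h ↦ ?_, by rintro ⟨rfl, rfl, rfl, rfl⟩; rfl⟩
  have h' := congrArg Subtype.val h
  exact ⟨congrFun (congrFun h' 0) 0, congrFun (congrFun h' 0) 1, congrFun (congrFun h' 0) 2,
    congrFun (congrFun h' 1) 2⟩

theorem one_eq_mk : (1 : swapAffine R S) = mk 1 0 0 0 := by
  rw [eq_mk 1]; simp

theorem zero_eq_mk : (0 : swapAffine R S) = mk 0 0 0 0 := by
  rw [eq_mk 0]; simp

theorem algebraMap_eq_mk (r : R) :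
    algebraMap R (swapAffine R S) r = mk (algebraMap R S r) 0 0 0 := by
  rw [eq_mk (algebraMap R _ r)]; simp [Matrix.algebraMap_matrix_apply]

theorem mk_pow_two_pow_eq_one (s t : S) (h4 : (4 : S) = 0) {k : ℕ} (hk : 2 ≤ k) :
    (mk 1 0 s t : swapAffine R S) ^ 2 ^ k = 1 := by
  have h : (mk 1 0 s t : swapAffine R S) ^ 2 ^ 2 = 1 := by
    rw [pow_two 2, pow_mul, pow_two, pow_two, mk_mul_mk, mk_mul_mk, one_eq_mk, mk_inj]
    exact ⟨by ring, by ring, by linear_combination s * h4, by linear_combination t * h4⟩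
  obtain ⟨j, rfl⟩ := Nat.exists_eq_add_of_le hk
  rw [pow_add, pow_mul, h, one_pow]

theorem mk_zero_one_pow (s t : S) (h4 : (4 : S) = 0) {k : ℕ} (hk : 3 ≤ k) :
    (mk 0 1 s t : swapAffine R S) ^ 2 ^ k = 1 := by
  obtain ⟨j, rfl⟩ := Nat.exists_eq_add_of_le' hk
  rw [show j + 3 = j + 2 + 1 from rfl, pow_succ', pow_mul, pow_two, mk_mul_mk]
  simpa using mk_pow_two_pow_eq_one (R := R) (t + s) (s + t) h4 (show 2 ≤ j + 2 by omega)

/-- The swap of coordinates and its translate satisfy the relations shared by `GroupG` and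
`GroupH` as soon as `4 = 0` in `S`. -/
theorem isInversionPair (h4 : (4 : S) = 0) {l : ℕ} (hl : 2 ≤ l) :
    IsInversionPair l (mk 0 1 0 0 : swapAffine R S) (mk 0 1 1 0) where
  sq_left := by
    simp [Commute, SemiconjBy, pow_two, mk_mul_mk]
  sq_right := by
    simp [Commute, SemiconjBy, pow_two, mk_mul_mk]
  pow_eq := by
    simp [mk_mul_mk, mk_pow_two_pow_eq_one, h4, hl]

/-- The ideal of the matrices `mk 0 0 s t`. -/
def radical (R S : Type*) [CommRing R] [CommRing S] [Algebra R S] :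
    TwoSidedIdeal (swapAffine R S) :=
  .mk' {A | ∃ s t, A = mk 0 0 s t}
    ⟨0, 0, zero_eq_mk⟩
    (by rintro _ _ ⟨s, t, rfl⟩ ⟨s', t', rfl⟩; exact ⟨s + s', t + t', by simp [mk_add_mk]⟩)
    (by rintro _ ⟨s, t, rfl⟩; exact ⟨-s, -t, by simp [neg_mk]⟩)
    (by
      rintro A _ ⟨s, t, rfl⟩
      obtain ⟨p, q, s', t', rfl⟩ := exists_eq_mk A
      simp [mk_mul_mk, mk_inj])
    (by
      rintro _ A ⟨s, t, rfl⟩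
      obtain ⟨p, q, s', t', rfl⟩ := exists_eq_mk A
      simp [mk_mul_mk, mk_inj])

theorem mem_radical {A : swapAffine R S} : A ∈ radical R S ↔ ∃ s t, A = mk 0 0 s t :=
  TwoSidedIdeal.mem_mk' ..

theorem mul_eq_zero_of_mem_radical (A : swapAffine R S) (hA : A ∈ radical R S)
    (B : swapAffine R S) (hB : B ∈ radical R S) : A * B = 0 := by
  obtain ⟨s, t, rfl⟩ := mem_radical.1 hA
  obtain ⟨s', t', rfl⟩ := mem_radical.1 hB
  simp [mk_mul_mk, zero_eq_mk]

theorem commutator_mem_radical (A B : swapAffine R S) : A * B - B * A ∈ radical R S := by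
  obtain ⟨p, q, s, t, rfl⟩ := exists_eq_mk A
  obtain ⟨p', q', s', t', rfl⟩ := exists_eq_mk B
  rw [mk_mul_mk, mk_mul_mk, mk_sub_mk]
  exact mem_radical.2 ⟨_, _, mk_inj.2 ⟨by ring, by ring, rfl, rfl⟩⟩

/-- The commutator of the swap and its translate is `mk 0 0 1 (-1)` up to sign. Multiplication by
`V = mk p q s t` scales it by `p - q` from the left and by `p + q` from the right, so it
anticommutes with `V` only if `2 * p = 0`. -/
theorem two_mul_eq_zero_of_mem {V : swapAffine R S}
    (h : mk 0 1 0 0 * mk 0 1 1 0 - mk 0 1 1 0 * mk 0 1 0 0 ∈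
    anticommutant (radical R S) mul_eq_zero_of_mem_radical commutator_mem_radical V) :
    2 * V.1 0 0 = 0 := by
  obtain ⟨p, q, s, t, rfl⟩ := exists_eq_mk V
  have h' := (mem_anticommutant.1 h).2
  simp only [mk_mul_mk, mk_sub_mk, mk_add_mk, zero_eq_mk, mk_inj] at h'
  have : (mk p q s t : swapAffine R S).1 0 0 = p := rfl
  rw [this]
  linear_combination -h'.2.2.1

/-- The ring homomorphism `mk p q s t ↦ F p + F q * γ`, where `γ ^ 2 = 1`: it forgets the
translation part and sends the swap to `γ`. -/
def linearPart {D : Type*} [CommRing D] (F : S →+* D) (γ : D) (hγ : γ ^ 2 = 1) :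
    swapAffine R S →+* D where
  toFun A := F (A.1 0 0) + F (A.1 0 1) * γ
  map_one' := by simp
  map_zero' := by simp
  map_add' A B := by
    simp only [AddMemClass.coe_add, Matrix.add_apply, map_add]; ring
  map_mul' A B := by
    obtain ⟨p, q, s, t, rfl⟩ := exists_eq_mk A
    obtain ⟨p', q', s', t', rfl⟩ := exists_eq_mk B
    rw [mk_mul_mk]
    simp only [mk, Matrix.of_apply, Matrix.cons_val', Matrix.cons_val_zero, Matrix.cons_val_one,
      Matrix.cons_val_fin_one, map_add, map_mul]
    linear_combination -F q * F q' * hγ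

theorem linearPart_apply {D : Type*} [CommRing D] (F : S →+* D) (γ : D) (hγ : γ ^ 2 = 1)
    (A : swapAffine R S) : linearPart F γ hγ A = F (A.1 0 0) + F (A.1 0 1) * γ := rfl

theorem linearPart_mk {D : Type*} [CommRing D] (F : S →+* D) (γ : D) (hγ : γ ^ 2 = 1)
    (p q s t : S) : linearPart F γ hγ (mk p q s t : swapAffine R S) = F p + F q * γ := rfl

end swapAffine

/-! ### Non-isomorphism when a quotient has characteristic four -/

open MonoidAlgebra swapAffine

section

variable {n m l : ℕ} {R : Type*} [CommRing R]

theorem two_mem_of_isPrime {r M : Ideal R} [M.IsPrime] (h4 : (4 : R) ∈ r) (hrM : r ≤ M) :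
    (2 : R) ∈ M := by
  refine ‹M.IsPrime›.mem_of_pow_mem 2 (hrM ?_)
  norm_num [h4]

theorem mem_of_two_mul_mem {r M : Ideal R} [M.IsMaximal] (hMr : M ^ 2 ≤ r) (h2 : (2 : R) ∈ M)
    (h2r : (2 : R) ∉ r) {v : R} (hv : 2 * v ∈ r) : v ∈ M := by
  by_contra h
  obtain ⟨w, i, hi, hw⟩ := (‹M.IsMaximal›).exists_inv h
  apply h2r
  have : (2 : R) * i ∈ r := hMr (pow_two M ▸ Ideal.mul_mem_mul h2 hi)
  have e : (2 : R) = w * (2 * v) + 2 * i := by linear_combination -2 * hw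
  rw [e]
  exact r.add_mem (r.mul_mem_left _ hv) this

open Multiplicative in
/-- An element `u` of the group algebra of `GroupH` with `u^(2^m) = 1` is not odd modulo `M`: the
sum `v` of its coefficients at the group elements of even length does not vanish modulo `M`.
Indeed, send both generators to a generator `g` of a cyclic group of order `2^(m+1)`. Over `R ⧸ M`
the `2^m`-th power map is additive, and it sends `g^i` to `1` or to `γ = g^(2^m)` according to the
parity of `i`. So `v^(2^m)` is the coefficient of `u^(2^m) = 1` at the identity. -/
theorem not_mem_of_pow_eq_one (hmn : m < n) {r M : Ideal R}
    [M.IsMaximal] (hrM : r ≤ M) (h2 : (2 : R) ∈ M)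
    (ρ : MonoidAlgebra R (GroupH n m l) →ₐ[R] swapAffine R (R ⧸ r))
    (h0 : ρ (of R _ (.of 0)) = mk 0 1 0 0) (h1 : ρ (of R _ (.of 1)) = mk 0 1 1 0)
    (u : MonoidAlgebra R (GroupH n m l)) (hu : u ^ 2 ^ m = 1) {v : R}
    (hv : (ρ u).1 0 0 = Ideal.Quotient.mk r v) :
    v ∉ M := by
  intro hvM
  let _ : Field (R ⧸ M) := Ideal.Quotient.field M
  have : CharP (R ⧸ M) 2 := CharTwo.of_one_ne_zero_of_two_eq_zero one_ne_zero
    (by rw [← map_ofNat (Ideal.Quotient.mk M) 2]; exact Ideal.Quotient.eq_zero_iff_mem.2 h2)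
  let C := Multiplicative (ZMod (2 ^ (m + 1)))
  let g : C := ofAdd 1
  let γ : C := g ^ 2 ^ m
  have hg (k : ℕ) : g ^ k = 1 ↔ 2 ^ (m + 1) ∣ k := by
    rw [← ZMod.natCast_eq_zero_iff, ← ofAdd_nsmul, ofAdd_eq_one, nsmul_one]
  have hγ : γ ≠ 1 := fun h ↦ by
    have := (Nat.pow_dvd_pow_iff_le_right (by norm_num)).1 ((hg _).1 h)
    omega
  have hγ2 : γ ^ 2 = 1 := by rw [← pow_mul, hg, pow_succ]
  let D := MonoidAlgebra (R ⧸ M) C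
  have : CharP D 2 := MonoidAlgebra.charP _ _ 2
  obtain ⟨Φ, hΦ0, hΦ1⟩ := GroupH.exists_algHom (n := n) (m := m) (l := l) (R := R)
    (a := of (R ⧸ M) C g) (b := of (R ⧸ M) C g) ⟨.all _ _, .all _ _, rfl⟩
    (by rw [← map_pow, (hg _).2 (pow_dvd_pow 2 hmn), map_one]) rfl
  let F : R ⧸ r →+* D :=
    (iterateFrobenius D 2 m).comp ((algebraMap (R ⧸ M) D).comp (Ideal.Quotient.factor hrM))
  let J := linearPart (R := R) F (of (R ⧸ M) C γ) (by rw [← map_pow, hγ2, map_one])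
  -- the `2^m`-th power of `Φ u` only depends on the linear part of `ρ u`
  have hJ : (iterateFrobenius D 2 m).comp Φ.toRingHom = J.comp ρ.toRingHom := by
    refine ringHom_ext_of_generators (GroupH.commutatorRelators_subset n m l) (fun s ↦ ?_) ?_ ?_
    · simp only [RingHom.comp_apply, AlgHom.toRingHom_eq_coe, RingHom.coe_coe, AlgHom.commutes,
        algebraMap_eq_mk, J, linearPart_mk, map_zero, zero_mul, add_zero, F]
      rfl
    · simp only [RingHom.comp_apply, AlgHom.toRingHom_eq_coe, RingHom.coe_coe, hΦ0, h0, J,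
        linearPart_mk, map_zero, map_one, one_mul, zero_add, iterateFrobenius_def, γ, map_pow]
    · simp only [RingHom.comp_apply, AlgHom.toRingHom_eq_coe, RingHom.coe_coe, hΦ1, h1, J,
        linearPart_mk, map_zero, map_one, one_mul, zero_add, iterateFrobenius_def, γ, map_pow]
  have key : J (ρ u) = 1 := by
    have := congrArg (fun f : _ →+* D ↦ f u) hJ
    simp only [RingHom.comp_apply, AlgHom.toRingHom_eq_coe, RingHom.coe_coe, iterateFrobenius_def,
      ← map_pow, hu, map_one] at this
    exact this.symm
  obtain ⟨w, hw⟩ := Ideal.Quotient.mk_surjective ((ρ u).1 0 1)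
  have hF (s : R) : F (Ideal.Quotient.mk r s) = single 1 (Ideal.Quotient.mk M s ^ 2 ^ m) := by
    change (algebraMap (R ⧸ M) D (Ideal.Quotient.mk M s)) ^ 2 ^ m = _
    rw [← map_pow]; rfl
  rw [linearPart_apply, hv, ← hw, hF, hF, Ideal.Quotient.eq_zero_iff_mem.2 hvM, zero_pow (by
    positivity), single_zero, zero_add, of_apply, single_mul_single, one_def, single_inj] at key
  simp [hγ] at key

/-- The commutators of the group algebra of `GroupG` anticommute with its second generator `y`
modulo the square of the commutator ideal. If the group algebras were isomorphic, then the image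
of `y` would have this property in the group algebra of `GroupH`, and the representation of
`GroupH` by affine maps would show that it is odd modulo `M`. -/
theorem isEmpty_algEquiv (hl : 2 ≤ l) (hlm : l < m) (hmn : m < n) {r M : Ideal R} (hM : M.IsMaximal)
    (hMr : M ^ 2 ≤ r) (hrM : r ≤ M) (h4 : CharP (R ⧸ r) 4) :
    IsEmpty (MonoidAlgebra R (GroupG n m l) ≃ₐ[R] MonoidAlgebra R (GroupH n m l)) := by
  refine ⟨fun f ↦ ?_⟩
  have h4S : (4 : R ⧸ r) = 0 := by exact_mod_cast CharP.cast_eq_zero (R ⧸ r) 4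
  have h4r : (4 : R) ∈ r := Ideal.Quotient.eq_zero_iff_mem.1 (by rwa [map_ofNat])
  have h2r : (2 : R) ∉ r := fun h ↦ by
    have := (CharP.cast_eq_zero_iff (R ⧸ r) 4 2).1
      (by rw [← map_natCast (Ideal.Quotient.mk r)]; exact Ideal.Quotient.eq_zero_iff_mem.2 h)
    norm_num at this
  have h2M := two_mem_of_isPrime h4r hrM
  obtain ⟨ρ, h0, h1⟩ := GroupH.exists_algHom (n := n) (m := m) (R := R)
    (isInversionPair (R := R) h4S hl)
    (mk_zero_one_pow _ _ h4S (by omega))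
    (by rw [mk_zero_one_pow _ _ h4S (by omega), mk_zero_one_pow _ _ h4S (by omega)])
  let x : MonoidAlgebra R (GroupG n m l) := of R _ (.of 0)
  let y : MonoidAlgebra R (GroupG n m l) := of R _ (.of 1)
  let θ := ρ.comp f.toAlgHom
  let D := anticommutant (radical R (R ⧸ r)) mul_eq_zero_of_mem_radical commutator_mem_radical (θ y)
  have hxy : θ y * θ x - θ x * θ y ∈ D := commutator_mem_anticommutant _ _
    ((isInversionPair_groupAlgebra (GroupG.commutatorRelators_subset n m l)).map θ)
  -- the commutator of the generators of `GroupH` lies in `D` too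
  have hab := commutator_mem_of_generators (GroupG.commutatorRelators_subset n m l) θ D hxy
    (f.symm (of R _ (.of 0))) (f.symm (of R _ (.of 1)))
  simp only [θ, AlgHom.comp_apply, AlgEquiv.coe_toAlgHom, AlgEquiv.apply_symm_apply, h0, h1] at hab
  obtain ⟨v, hv⟩ := Ideal.Quotient.mk_surjective ((θ y).1 0 0)
  have h2v : 2 * v ∈ r := Ideal.Quotient.eq_zero_iff_mem.1 (by
    rw [map_mul, map_ofNat, hv]; exact two_mul_eq_zero_of_mem hab)
  refine not_mem_of_pow_eq_one hmn hrM h2M ρ h0 h1 (f y) ?_ hv.symm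
    (mem_of_two_mul_mem hMr h2M h2r h2v)
  rw [← map_pow, ← map_pow, GroupG.of_one_pow, map_one, map_one]

end

theorem theoremA (n m l : ℕ) (hl : 2 ≤ l) (hlm : l < m) (hmn : m < n) :
    (∀ (R : Type u) [CommRing R] (r M : Ideal R),
        M.IsMaximal → M ^ 2 ≤ r → r ≤ M → CharP (R ⧸ r) 4 →
        IsEmpty (MonoidAlgebra R (GroupG n m l) ≃ₐ[R] MonoidAlgebra R (GroupH n m l))) ∧
    IsEmpty (MonoidAlgebra (ZMod 4) (GroupG n m l) ≃ₐ[ZMod 4]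
        MonoidAlgebra (ZMod 4) (GroupH n m l)) ∧
    (∀ (R : Type u) [CommRing R], CharP R 2 →
        Nonempty (MonoidAlgebra R (GroupG n m l) ≃ₐ[R] MonoidAlgebra R (GroupH n m l))) := by
  refine ⟨fun R _ r M hM hMr hrM h4 ↦ isEmpty_algEquiv hl hlm hmn hM hMr hrM h4, ?_,
    fun R _ _ ↦ nonempty_algEquiv_of_charTwo hlm⟩
  -- the kernel of `ℤ/4 → ℤ/2` is a maximal ideal of square zero
  let φ := ZMod.castHom (show 2 ∣ 4 by norm_num) (ZMod 2)
  refine isEmpty_algEquiv hl hlm hmn (r := ⊥) (M := RingHom.ker φ)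
    (RingHom.ker_isMaximal_of_surjective φ (ZMod.ringHom_surjective φ)) ?_ bot_le ?_
  · have h : ∀ a b : ZMod 4, φ a = 0 → φ b = 0 → a * b = 0 := by decide
    rw [pow_two, Ideal.mul_le]
    exact fun a ha b hb ↦ h a b ha hb
  · exact charP_of_injective_ringHom
      (f := ((RingEquiv.quotientBot (ZMod 4)).symm : ZMod 4 →+* ZMod 4 ⧸ (⊥ : Ideal (ZMod 4))))
      (RingEquiv.injective _) 4
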